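/- Let $n\ge 0$, let $N=\mathbb Z^{n+1}$ and $M=\mathbb Z^{n+1}$ be dual lattices under the standard pairing $(\cdot,\cdot)$, and let $\sigma=\mathbb R_{\ge 0}^{n+1}\subset N_{\mathbb R}$ be the standard cone, so that $\mathbb C^{n+1}$ is the toric variety of the fan of faces of $\sigma$. Let $f=\sum_{m} c_m x^m$ be a complex power series in $x_0,\dots,x_n$ that converges (absolutely) at every point of an open neighbourhood $U$ of the origin in $\mathbb C^{n+1}$ (for instance a polynomial, with $U=\mathbb C^{n+1}$), and let $X=\{x\in U: f(x)=0\}$. Assume that $X$ contains none of the sets $\{x\in U: x_i=0\}$, $0\le i\le n$. The Newton polyhedron of $f$ is $\Gamma_+=\operatorname{conv}\bigcup_{c_m\ne 0}(m+\mathbb R_{\ge 0}^{n+1})$. The trace of $a\in\sigma$ is the face $\operatorname{tr}(a)=\{p\in\Gamma_+: (a,p)=\min_{q\in\Gamma_+}(a,q)\}$. The Newton diagram $\Gamma$ is the union of the compact faces of $\Gamma_+$, and its vertices are the vertices of $\Gamma_+$. The Newton fan $\Sigma_{\Gamma(f)}$ consists of the closures of the classes of covectors $a\in\sigma$ with the same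 trace. Let $\Sigma$ be a simple subdivision of $\Sigma_{\Gamma(f)}$: a finite fan with support $\sigma$, each of whose cones is generated by part of a basis of $N$ and is contained in a cone of $\Sigma_{\Gamma(f)}$. Let $\mu:T_N(\Sigma)\to\mathbb C^{n+1}$ be the induced toric morphism, and let the proper transform of $X$ be the closure in $\mu^{-1}(U)$ of $\mu^{-1}(X\setminus\mu(\operatorname{Exc}(\mu)))$. Let $a\in N$ be a vector in the relative interior of $\sigma$ (all coordinates of $a$ are positive) that spans a ray of $\Sigma$, and let $E_a\subset T_N(\Sigma)$ be the torus invariant prime divisor corresponding to this ray (it is $\mu$-exceptional if $n\ge1$). If $E_a$ does not intersect the proper transform of $X$, then $a$ belongs to a unique cone of $\Sigma_{\Gamma(f)}$. Moreover $a$ then lies in the interior of a maximal cone of $\Sigma_{\Gamma(f)}$, and the trace of $a$ is a vertex of $\Gamma$. -/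

import Mathlib

open Set Topology

noncomputable section

namespace NewtonToric

/-! ### Lattice vectors and power series -/

/-- A lattice (co)vector, seen as a real (co)vector. Both `N` and `M` are `ℤ^d`, paired by the
standard dot product `⬝ᵥ`. -/
def realVec {d : ℕ} (a : Fin d → ℤ) : Fin d → ℝ := fun i => (a i : ℝ)

/-- The standard cone `σ = ℝ_{≥ 0}^d`, with basis the standard vectors. -/
def orthant (d : ℕ) : PointedCone ℝ (Fin d → ℝ) := PointedCone.positive ℝ (Fin d → ℝ)

/-- The term `c_m x^m` of the power series `F = ∑ c_m x^m` at the point `x`. -/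
def term {d : ℕ} (F : MvPowerSeries (Fin d) ℂ) (x : Fin d → ℂ) (m : Fin d →₀ ℕ) : ℂ :=
  MvPowerSeries.coeff m F * ∏ i, x i ^ m i

/-- The hypersurface `(F = 0)` in a set `U` on which the series `F` converges. -/
def hypersurface {d : ℕ} (F : MvPowerSeries (Fin d) ℂ) (U : Set (Fin d → ℂ)) :
    Set (Fin d → ℂ) :=
  {x ∈ U | ∑' m, term F x m = 0}

/-! ### The Newton polyhedron and its fan -/

/-- The Newton polyhedron `Γ₊`: the convex hull of the union of the sets `m + ℝ_{≥ 0}^d`, over the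
exponents `m` of the monomials that occur in `F`. -/
def newtonPolyhedron {d : ℕ} (F : MvPowerSeries (Fin d) ℂ) : Set (Fin d → ℝ) :=
  convexHull ℝ
    (⋃ m ∈ {m : Fin d →₀ ℕ | MvPowerSeries.coeff m F ≠ 0}, {p | ∀ i, (m i : ℝ) ≤ p i})

/-- The trace of the covector `a`: the set of points of `Γ₊` at which `(a, ·)` attains its minimum
over `Γ₊`. -/
def trace {d : ℕ} (F : MvPowerSeries (Fin d) ℂ) (a : Fin d → ℝ) : Set (Fin d → ℝ) :=
  {p ∈ newtonPolyhedron F | ∀ q ∈ newtonPolyhedron F, a ⬝ᵥ p ≤ a ⬝ᵥ q}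

/-- The cones of the Newton fan: the closures of the classes of covectors in the standard cone
under the relation of having the same trace. -/
def newtonFan {d : ℕ} (F : MvPowerSeries (Fin d) ℂ) : Set (Set (Fin d → ℝ)) :=
  {C | ∃ a ∈ orthant d, C = closure {b | b ∈ orthant d ∧ trace F b = trace F a}}

/-! ### Fans -/

/-- A (finite) fan of rational strongly convex polyhedral cones in `ℝ^d`. -/
structure IsFan {d : ℕ} (Δ : Set (PointedCone ℝ (Fin d → ℝ))) : Prop where
  finite : Δ.Finite
  rational : ∀ τ ∈ Δ, ∃ s : Finset (Fin d → ℤ), τ = PointedCone.hull ℝ (realVec '' s)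
  salient : ∀ τ ∈ Δ, ∀ u ∈ τ, -u ∈ τ → u = 0
  face_mem : ∀ τ ∈ Δ, ∀ τ' : PointedCone ℝ (Fin d → ℝ), τ'.IsFaceOf τ → τ' ∈ Δ
  inter_face : ∀ τ ∈ Δ, ∀ τ' ∈ Δ, (τ ⊓ τ').IsFaceOf τ

/-- A cone is simple (nonsingular) if it is generated by a part of a basis of the lattice `ℤ^d`. -/
def IsSimpleCone {d : ℕ} (τ : PointedCone ℝ (Fin d → ℝ)) : Prop :=
  ∃ (b : Module.Basis (Fin d) ℤ (Fin d → ℤ)) (s : Set (Fin d)),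
    τ = PointedCone.hull ℝ ((fun i => realVec (b i)) '' s)

/-- `Δ` is a fan of simple cones that subdivides the Newton fan of `F`: it has the same support,
and each of its cones lies in a cone of the Newton fan. -/
structure IsSimpleSubdivision {d : ℕ} (Δ : Set (PointedCone ℝ (Fin d → ℝ)))
    (F : MvPowerSeries (Fin d) ℂ) : Prop where
  isFan : IsFan Δ
  simple : ∀ τ ∈ Δ, IsSimpleCone τ
  support : ⋃ τ ∈ Δ, (τ : Set (Fin d → ℝ)) = ⋃₀ newtonFan F
  refines : ∀ τ ∈ Δ, ∃ C ∈ newtonFan F, (τ : Set (Fin d → ℝ)) ⊆ C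

theorem IsSimpleSubdivision.le_orthant {d : ℕ} {Δ : Set (PointedCone ℝ (Fin d → ℝ))}
    {F : MvPowerSeries (Fin d) ℂ} (h : IsSimpleSubdivision Δ F) : ∀ τ ∈ Δ, τ ≤ orthant d := by
  intro τ hτ u hu
  obtain ⟨C, ⟨a, -, rfl⟩, hC⟩ := h.refines τ hτ
  have hcl : IsClosed {b : Fin d → ℝ | 0 ≤ b} := isClosed_Ici
  have hsub : {b | b ∈ orthant d ∧ trace F b = trace F a} ⊆ {b : Fin d → ℝ | 0 ≤ b} :=
    fun b hb => by simpa [orthant] using hb.1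
  simpa [orthant] using closure_minimal hsub hcl (hC hu)

/-! ### The toric variety of a fan, as a complex analytic space of points -/

/-- The monoid `τ^∨ ∩ M`. -/
def dualMonoid {d : ℕ} (τ : PointedCone ℝ (Fin d → ℝ)) : AddSubmonoid (Fin d → ℤ) where
  carrier := {m | ∀ u ∈ τ, 0 ≤ u ⬝ᵥ realVec m}
  zero_mem' := by
    intro u _
    simp [realVec, dotProduct]
  add_mem' := by
    intro m m' hm hm' u hu
    have h : u ⬝ᵥ realVec (m + m') = u ⬝ᵥ realVec m + u ⬝ᵥ realVec m' := by
      rw [← dotProduct_add]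
      congr 1
      ext i
      simp [realVec]
    rw [h]
    exact add_nonneg (hm u hu) (hm' u hu)

theorem dualMonoid_anti {d : ℕ} {τ τ' : PointedCone ℝ (Fin d → ℝ)} (h : τ ≤ τ') :
    dualMonoid τ' ≤ dualMonoid τ :=
  fun _ hm u hu => hm u (h hu)

/-- The affine toric variety `U_τ = Spec ℂ[τ^∨ ∩ M]`: its complex points are the monoid
homomorphisms from `τ^∨ ∩ M` to `(ℂ, ·)`. As a subtype of a product of copies of `ℂ` it carries
the topology of pointwise convergence, which is its classical topology. -/
def AffineToric {d : ℕ} (τ : PointedCone ℝ (Fin d → ℝ)) : Type :=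
  {x : dualMonoid τ → ℂ // x 0 = 1 ∧ ∀ m m', x (m + m') = x m * x m'}

instance {d : ℕ} (τ : PointedCone ℝ (Fin d → ℝ)) : TopologicalSpace (AffineToric τ) :=
  inferInstanceAs (TopologicalSpace
    {x : dualMonoid τ → ℂ // x 0 = 1 ∧ ∀ m m', x (m + m') = x m * x m'})

/-- The open immersion `U_τ → U_τ'` for a face `τ` of `τ'`: restriction to `τ'^∨ ∩ M`. -/
def AffineToric.incl {d : ℕ} {τ τ' : PointedCone ℝ (Fin d → ℝ)} (h : τ ≤ τ')
    (x : AffineToric τ) : AffineToric τ' :=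
  ⟨fun m => x.1 ⟨m.1, dualMonoid_anti h m.2⟩, x.2.1,
    fun m m' => x.2.2 ⟨m.1, dualMonoid_anti h m.2⟩ ⟨m'.1, dualMonoid_anti h m'.2⟩⟩

/-- The gluing relation on the disjoint union of the charts. (In a fan, a cone that is contained
in another one is a face of it.) -/
inductive Glue {d : ℕ} (Δ : Set (PointedCone ℝ (Fin d → ℝ))) :
    (Σ τ : Δ, AffineToric τ.1) → (Σ τ : Δ, AffineToric τ.1) → Prop
  | incl (τ τ' : Δ) (h : τ.1 ≤ τ'.1) (x : AffineToric τ.1) : Glue Δ ⟨τ, x⟩ ⟨τ', x.incl h⟩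

/-- The toric variety `T_N(Δ)` with its classical topology: the charts `U_τ`, for `τ ∈ Δ`, glued
along the open immersions given by the faces. -/
def ToricVariety {d : ℕ} (Δ : Set (PointedCone ℝ (Fin d → ℝ))) : Type := Quot (Glue Δ)

instance {d : ℕ} (Δ : Set (PointedCone ℝ (Fin d → ℝ))) : TopologicalSpace (ToricVariety Δ) :=
  inferInstanceAs (TopologicalSpace (Quot (Glue Δ)))

/-- The chart `U_τ → T_N(Δ)`. -/
def chart {d : ℕ} {Δ : Set (PointedCone ℝ (Fin d → ℝ))} (τ : Δ) (x : AffineToric τ.1) :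
    ToricVariety Δ :=
  Quot.mk _ ⟨τ, x⟩

theorem single_mem_dualMonoid {d : ℕ} {τ : PointedCone ℝ (Fin d → ℝ)} (h : τ ≤ orthant d)
    (i : Fin d) : Pi.single i 1 ∈ dualMonoid τ := by
  intro u hu
  have h0 : 0 ≤ u := by simpa [orthant] using h hu
  exact Finset.sum_nonneg fun j _ => mul_nonneg (h0 j) (by
    by_cases hj : j = i
    · subst hj; simp [realVec]
    · simp [realVec, Pi.single_eq_of_ne hj])

/-- The toric morphism `μ : T_N(Δ) → T_N({faces of σ}) = ℂ^d`, for a fan `Δ` with cones in the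
standard cone `σ`: the coordinate `x_i` of `μ(x)` is the value of `x` at the `i`-th standard vector
of `M`. -/
def toricMap {d : ℕ} (Δ : Set (PointedCone ℝ (Fin d → ℝ))) (hΔ : ∀ τ ∈ Δ, τ ≤ orthant d) :
    ToricVariety Δ → (Fin d → ℂ) :=
  Quot.lift (fun p i => p.2.1 ⟨Pi.single i 1, single_mem_dualMonoid (hΔ p.1.1 p.1.2) i⟩)
    (by rintro _ _ ⟨τ, τ', h, x⟩; rfl)

/-- The torus orbit `O_τ` in `T_N(Δ)`: the points of `U_τ` at which exactly the characters
orthogonal to `τ` do not vanish. -/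
def orbit {d : ℕ} {Δ : Set (PointedCone ℝ (Fin d → ℝ))} (τ : Δ) : Set (ToricVariety Δ) :=
  chart τ '' {x | ∀ m : dualMonoid τ.1, x.1 m ≠ 0 ↔ ∀ u ∈ τ.1, u ⬝ᵥ realVec m.1 = 0}

/-- The ray spanned by the lattice vector `a`. -/
def ray {d : ℕ} (a : Fin d → ℤ) : PointedCone ℝ (Fin d → ℝ) := PointedCone.hull ℝ {realVec a}

/-- The torus invariant prime divisor `E_a` of `T_N(Δ)`, for a lattice vector `a` that spans a ray
of `Δ`: the closure of the orbit of that ray. -/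
def divisor {d : ℕ} {Δ : Set (PointedCone ℝ (Fin d → ℝ))} (a : Fin d → ℤ) (ha : ray a ∈ Δ) :
    Set (ToricVariety Δ) :=
  closure (orbit ⟨ray a, ha⟩)

/-- The exceptional locus of `μ : T_N(Δ) → ℂ^d`, for a simple fan `Δ` that subdivides the standard
cone: the union of the exceptional divisors, i.e. of the divisors of the rays of `Δ` other than the
edges of the standard cone. -/
def exceptionalLocus {d : ℕ} (Δ : Set (PointedCone ℝ (Fin d → ℝ))) : Set (ToricVariety Δ) :=
  ⋃ (b : Fin d → ℤ) (hb : ray b ∈ Δ) (_ : b ≠ 0) (_ : ∀ i, ray b ≠ ray (Pi.single i 1)),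
    divisor b hb

/-- The proper transform of `X ⊆ ℂ^d` in `T_N(Δ)`: the closure of the preimage of the part of `X`
over which `μ` is an isomorphism. (If `X` is closed in an open set `U`, only the part of this
closure over `U` matters, and it is the proper transform under `μ⁻¹(U) → U`.) -/
def properTransform {d : ℕ} (Δ : Set (PointedCone ℝ (Fin d → ℝ)))
    (hΔ : ∀ τ ∈ Δ, τ ≤ orthant d) (X : Set (Fin d → ℂ)) : Set (ToricVariety Δ) :=
  closure (toricMap Δ hΔ ⁻¹' (X \ toricMap Δ hΔ '' exceptionalLocus Δ))

end NewtonToric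

end

noncomputable section

namespace NewtonToric

/-! ### Zeros near the exceptional divisor -/

/-! Give the monomial `x^m` the weight `(a, m)`, and let `k` be the least weight occurring in `F`.
The claim reduces to uniqueness of the monomial of weight `k`.

Suppose two monomials tie. Restrict `F` to the surface `x_i = t^{a_i} s^{w_i}`, with `w` separating
the monomials of weight `k`. Then `t^{-k} F` tends, as `t → 0`, to a polynomial `P(s)` with at least
two terms, which has a root `s₀ ≠ 0`. By the minimum modulus principle the root persists for small
`t ≠ 0` (`exists_zero_near`). The resulting zeros of `F` have nonzero coordinates, so they lie
outside the image of the exceptional locus. In the chart of the ray of `a` they accumulate at a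
point of the orbit of that ray, so `E_a` meets the proper transform
(`divisor_inter_properTransform_nonempty`).

If the minimal monomial `m₀` is unique, all covectors near `a` have trace `{m₀}`
(`eventually_trace_eq`). The statements on the Newton fan follow formally
(`newtonFan_of_eventually_trace_eq`). -/

theorem exists_ne_zero_root (P : Polynomial ℂ) {i j : ℕ} (hij : i ≠ j) (hi : P.coeff i ≠ 0)
    (hj : P.coeff j ≠ 0) : ∃ s, s ≠ 0 ∧ P.eval s = 0 := by
  have hP : P ≠ 0 := by rintro rfl; simp at hi
  obtain ⟨Q, hQ, hdvd⟩ := Polynomial.exists_eq_pow_rootMultiplicity_mul_and_not_dvd P hP 0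
  simp only [map_zero, sub_zero] at hQ hdvd
  set r := P.rootMultiplicity 0
  -- If `Q` were constant, `P` would be a monomial, with a single nonzero coefficient.
  have hdeg : Q.degree ≠ 0 := by
    intro h
    rw [Polynomial.eq_C_of_degree_eq_zero h, mul_comm] at hQ
    rw [hQ, Polynomial.coeff_C_mul_X_pow] at hi hj
    have h1 : i = r := by by_contra h; simp [h] at hi
    have h2 : j = r := by by_contra h; simp [h] at hj
    exact hij (h1.trans h2.symm)
  obtain ⟨s, hs⟩ := IsAlgClosed.exists_root Q hdeg
  refine ⟨s, ?_, ?_⟩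
  · rintro rfl
    exact hdvd (Polynomial.X_dvd_iff.2 (by rwa [Polynomial.coeff_zero_eq_eval_zero]))
  · rw [hQ, Polynomial.eval_mul, hs.eq_zero, mul_zero]

/-- A holomorphic function that is smaller at the centre of a disc than on its boundary has a zero
in the disc. -/
theorem exists_zero_of_norm_lt {g : ℂ → ℂ} {z : ℂ} {r η : ℝ} (hr : 0 < r) (hη : 0 < η)
    (hg : ∀ s ∈ Metric.closedBall z r, DifferentiableAt ℂ g s) (hz : ‖g z‖ < η)
    (hs : ∀ s ∈ Metric.sphere z r, η ≤ ‖g s‖) : ∃ s ∈ Metric.closedBall z r, g s = 0 := by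
  by_contra! h
  -- Without zeros, the maximum principle applies to `1/g` and contradicts the bounds.
  have hd : DiffContOnCl ℂ (fun s => (g s)⁻¹) (Metric.ball z r) := by
    apply DifferentiableOn.diffContOnCl
    rw [closure_ball z hr.ne']
    exact fun s hs => ((hg s hs).inv (h s hs)).differentiableWithinAt
  have := Complex.norm_le_of_forall_mem_frontier_norm_le Metric.isBounded_ball hd (C := η⁻¹)
    (fun s hs' => by
      rw [frontier_ball z hr.ne'] at hs'
      rw [norm_inv]
      exact inv_anti₀ hη (hs s hs')) (subset_closure (Metric.mem_ball_self hr))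
  rw [norm_inv] at this
  have h0 : 0 < ‖g z‖ := norm_pos_iff.2 (h z (Metric.mem_closedBall_self hr.le))
  exact absurd ((inv_le_inv₀ h0 hη).1 this) (not_le.2 hz)

/-- If at least two terms of a double power series `∑ c_m t^{A m} s^{W m}` have the least order in
`t`, its zero set has a branch that passes through a point `(0, s₀)` with `s₀ ≠ 0`. -/
theorem exists_zero_near {ι : Type*} (c : ι → ℂ) (A W : ι → ℕ) (k : ℕ)
    (hk : ∀ m, c m ≠ 0 → k ≤ A m) (S : Finset ι) (hS : ∀ m, m ∈ S ↔ c m ≠ 0 ∧ A m = k)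
    (hW : InjOn W S) {m₁ m₂ : ι} (h₁ : m₁ ∈ S) (h₂ : m₂ ∈ S) (h₁₂ : m₁ ≠ m₂)
    (hsum : ∀ R : ℝ, 0 < R → ∃ t₀ : ℝ, 0 < t₀ ∧ Summable fun m => ‖c m‖ * t₀ ^ A m * R ^ W m) :
    ∃ s₀ : ℂ, s₀ ≠ 0 ∧ ∀ ε > 0, ∃ t s : ℂ, t ≠ 0 ∧ ‖t‖ < ε ∧ ‖s - s₀‖ < ε ∧
      ∑' m, c m * t ^ A m * s ^ W m = 0 := by
  classical
  set P : Polynomial ℂ := ∑ m ∈ S, Polynomial.monomial (W m) (c m) with hPdef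
  have hcoeff : ∀ m ∈ S, P.coeff (W m) = c m := by
    intro m hm
    rw [hPdef, Polynomial.finsetSum_coeff, Finset.sum_eq_single m]
    · simp
    · intro m' hm' hne
      rw [Polynomial.coeff_monomial, if_neg fun h => hne (hW hm' hm h)]
    · exact fun h => absurd hm h
  have hc : ∀ m ∈ S, P.coeff (W m) ≠ 0 := fun m hm => by
    rw [hcoeff m hm]; exact ((hS m).1 hm).1
  obtain ⟨s₀, hs₀, hPs₀⟩ := exists_ne_zero_root P (fun h => h₁₂ (hW h₁ h₂ h)) (hc _ h₁) (hc _ h₂)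
  have hP0 : P ≠ 0 := fun h => hc _ h₁ (by simp [h])
  refine ⟨s₀, hs₀, fun ε hε => ?_⟩
  obtain ⟨r, hr, hrε, hroot⟩ : ∃ r > 0, r < ε ∧ ∀ s ∈ Metric.sphere s₀ r, P.eval s ≠ 0 := by
    have hfin : ((P.rootSet ℂ) \ {s₀}).Finite := (P.rootSet_finite ℂ).subset sdiff_subset
    obtain ⟨δ, hδ, hball⟩ := Metric.mem_nhds_iff.1 (hfin.isClosed.compl_mem_nhds (x := s₀) (by simp))
    refine ⟨min δ ε / 2, by positivity, ?_, fun s hs h => ?_⟩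
    · linarith [min_le_right δ ε]
    · have h1 : dist s s₀ = min δ ε / 2 := hs
      have hm : 0 < min δ ε := lt_min hδ hε
      have : s ∈ Metric.ball s₀ δ := by
        rw [Metric.mem_ball, h1]; linarith [min_le_left δ ε]
      refine hball this ⟨?_, ?_⟩
      · rw [Polynomial.mem_rootSet]
        exact ⟨hP0, by simpa [Polynomial.aeval_def, Polynomial.eval₂_eq_eval_map] using h⟩
      · rintro rfl
        rw [dist_self] at h1
        linarith
  obtain ⟨η, hη, hPη⟩ : ∃ η > 0, ∀ s ∈ Metric.sphere s₀ r, η ≤ ‖P.eval s‖ := by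
    have hne : (Metric.sphere s₀ r).Nonempty := NormedSpace.sphere_nonempty.2 hr.le
    obtain ⟨z, hz, hmin⟩ := (isCompact_sphere s₀ r).exists_isMinOn hne
      (f := fun s => ‖P.eval s‖) (by fun_prop)
    exact ⟨_, norm_pos_iff.2 (hroot z hz), fun s hs => hmin hs⟩
  -- This radius depends on the root found above, which is why `hsum` is required for every `R`.
  set R := ‖s₀‖ + r + 1 with hR
  have hR0 : 0 < R := by positivity
  obtain ⟨t₀, ht₀, hsumR⟩ := hsum R hR0
  set b : ι → ℝ := fun m => ‖c m‖ * t₀ ^ A m * R ^ W m with hb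
  have hb0 : ∀ m, 0 ≤ b m := fun m => by positivity
  set M := ∑' m, b m / t₀ ^ (k + 1) with hM
  have hM0 : 0 ≤ M := tsum_nonneg fun m => by have := hb0 m; positivity
  -- `t * M` will bound the distance to `P`. Being below `η / 2`, it puts the norm below `η / 2` at
  -- `s₀` and above it on the circle.
  obtain ⟨t, ht, htt₀, htε, htM⟩ : ∃ t : ℝ, 0 < t ∧ t ≤ t₀ ∧ t < ε ∧ t * M < η / 2 := by
    refine ⟨min t₀ (min (ε / 2) (η / (2 * (M + 1)) )), by positivity, min_le_left _ _, ?_, ?_⟩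
    · exact ((min_le_right _ _).trans (min_le_left _ _)).trans_lt (by linarith)
    · have h : min t₀ (min (ε / 2) (η / (2 * (M + 1)) )) ≤ η / (2 * (M + 1)) :=
        (min_le_right _ _).trans (min_le_right _ _)
      have h0 : 0 < η / (2 * (M + 1)) := by positivity
      calc _ ≤ η / (2 * (M + 1)) * M := by gcongr
        _ < η / (2 * (M + 1)) * (M + 1) := by gcongr; linarith
        _ = η / 2 := by field_simp
  have hpow : ∀ m, c m ≠ 0 → t ^ (A m - k) ≤ t₀ ^ A m / t₀ ^ k := by
    intro m hm
    rw [div_eq_mul_inv, ← pow_sub₀ t₀ ht₀.ne' (hk m hm)]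
    gcongr
  have hpow' : ∀ m, c m ≠ 0 → m ∉ S → t ^ (A m - k) ≤ t * (t₀ ^ A m / t₀ ^ (k + 1)) := by
    intro m hm hmS
    have h1 : k + 1 ≤ A m := lt_of_le_of_ne (hk m hm) fun h => hmS ((hS m).2 ⟨hm, h.symm⟩)
    rw [div_eq_mul_inv, ← pow_sub₀ t₀ ht₀.ne' h1, show A m - k = (A m - (k + 1)) + 1 by omega, pow_succ, mul_comm]
    gcongr
  -- The series divided by `t ^ k`. The truncated subtraction is harmless: `A m < k` forces `c m =
  -- 0`.
  set u : ι → ℂ → ℂ := fun m s => c m * (t : ℂ) ^ (A m - k) * s ^ W m with hu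
  have hubd : ∀ m s, ‖s‖ < R → ‖u m s‖ ≤ b m / t₀ ^ k := by
    intro m s hs
    by_cases hm : c m = 0
    · simp [hu, hb, hm]
    · have h1 := hpow m hm
      calc ‖u m s‖ = ‖c m‖ * t ^ (A m - k) * ‖s‖ ^ W m := by
            simp [hu, abs_of_pos ht]
        _ ≤ ‖c m‖ * (t₀ ^ A m / t₀ ^ k) * R ^ W m := by gcongr
        _ = b m / t₀ ^ k := by simp only [hb]; ring
  have hubd' : ∀ m s, ‖s‖ < R → ‖u m s - if m ∈ S then c m * s ^ W m else 0‖ ≤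
      t * (b m / t₀ ^ (k + 1)) := by
    intro m s hs
    have hpos : 0 ≤ t * (b m / t₀ ^ (k + 1)) := by have := hb0 m; positivity
    by_cases hmS : m ∈ S
    · have h1 := ((hS m).1 hmS).2
      simpa [hu, hmS, h1] using hpos
    by_cases hm : c m = 0
    · simpa [hu, hmS, hm] using hpos
    · have h1 := hpow' m hm hmS
      calc ‖u m s - if m ∈ S then c m * s ^ W m else 0‖ = ‖c m‖ * t ^ (A m - k) * ‖s‖ ^ W m := by
            simp [hu, abs_of_pos ht, hmS]
        _ ≤ ‖c m‖ * (t * (t₀ ^ A m / t₀ ^ (k + 1))) * R ^ W m := by gcongr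
        _ = _ := by simp only [hb]; ring
  have hus : ∀ s, ‖s‖ < R → Summable fun m => u m s := fun s hs =>
    Summable.of_norm_bounded (hsumR.div_const _) fun m => hubd m s hs
  have hPs : ∀ s, HasSum (fun m => if m ∈ S then c m * s ^ W m else 0) (P.eval s) := by
    intro s
    have : P.eval s = ∑ m ∈ S, if m ∈ S then c m * s ^ W m else 0 := by
      rw [hPdef, Polynomial.eval_finsetSum]
      exact Finset.sum_congr rfl fun m hm => by simp [hm]
    rw [this]
    exact hasSum_sum_of_ne_finset_zero fun m hm => if_neg hm
  have hclose : ∀ s, ‖s‖ < R → ‖∑' m, u m s - P.eval s‖ ≤ t * M := by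
    intro s hs
    rw [← ((hus s hs).hasSum.sub (hPs s)).tsum_eq, hM, ← tsum_mul_left]
    exact tsum_of_norm_bounded ((hsumR.div_const _).mul_left t).hasSum fun m => hubd' m s hs
  have hsR : ∀ s ∈ Metric.closedBall s₀ r, ‖s‖ < R := by
    intro s hs
    have h1 : ‖s - s₀‖ ≤ r := by simpa [dist_eq_norm] using hs
    have h2 := norm_sub_norm_le s s₀
    linarith
  have hdiff : DifferentiableOn ℂ (fun s => ∑' m, u m s) (Metric.ball 0 R) :=
    Complex.differentiableOn_tsum_of_summable_norm (hsumR.div_const (t₀ ^ k))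
      (fun m => by simp only [hu]; fun_prop) Metric.isOpen_ball
      fun m s hs => hubd m s (by simpa using hs)
  obtain ⟨s, hs, hs0⟩ := exists_zero_of_norm_lt (g := fun s => ∑' m, u m s) hr (half_pos hη)
    (fun s hs => hdiff.differentiableAt (Metric.isOpen_ball.mem_nhds (by simpa using hsR s hs)))
    (by
      have := hclose s₀ (hsR s₀ (Metric.mem_closedBall_self hr.le))
      rw [hPs₀, sub_zero] at this
      exact this.trans_lt htM)
    (fun s hs => by
      have h1 := hclose s (hsR s (Metric.sphere_subset_closedBall hs))
      have h2 := hPη s hs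
      have h3 := norm_sub_norm_le (P.eval s) (∑' m, u m s)
      rw [norm_sub_rev] at h3
      linarith)
  refine ⟨t, s, by exact_mod_cast ht.ne', by simpa [abs_of_pos ht] using htε, ?_, ?_⟩
  · have h1 : ‖s - s₀‖ ≤ r := by simpa [dist_eq_norm] using hs
    exact h1.trans_lt hrε
  · have : ∀ m, c m * (t : ℂ) ^ A m * s ^ W m = (t : ℂ) ^ k * u m s := by
      intro m
      by_cases hm : c m = 0
      · simp [hu, hm]
      · obtain ⟨l, hl⟩ := Nat.exists_eq_add_of_le (hk m hm)
        simp only [hu, hl, Nat.add_sub_cancel_left]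
        ring
    simp_rw [this, tsum_mul_left]
    rw [hs0, mul_zero]

/-! ### The Newton fan near a covector with a unique minimal monomial -/

/-- The exponent `m`, seen as a real vector. -/
def expVec {d : ℕ} (m : Fin d →₀ ℕ) : Fin d → ℝ := fun i => (m i : ℝ)

theorem expVec_mem_newtonPolyhedron {d : ℕ} {F : MvPowerSeries (Fin d) ℂ} {m : Fin d →₀ ℕ}
    (hm : MvPowerSeries.coeff m F ≠ 0) : expVec m ∈ newtonPolyhedron F :=
  subset_convexHull ℝ _ (mem_biUnion (x := m) hm fun _ => le_rfl)

/-- An open half-space together with one boundary point is convex, so it suffices to check the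
generating orthants. On the orthant at `m₀`, positivity of every `b i` gives strictness away from
the apex. -/
theorem eq_or_lt_of_mem_newtonPolyhedron {d : ℕ} {F : MvPowerSeries (Fin d) ℂ}
    {b : Fin d → ℝ} (hb : ∀ i, 0 < b i) {m₀ : Fin d →₀ ℕ}
    (hmin : ∀ m, MvPowerSeries.coeff m F ≠ 0 → m ≠ m₀ → b ⬝ᵥ expVec m₀ < b ⬝ᵥ expVec m)
    {p : Fin d → ℝ} (hp : p ∈ newtonPolyhedron F) :
    p = expVec m₀ ∨ b ⬝ᵥ expVec m₀ < b ⬝ᵥ p := by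
  have hconv : Convex ℝ {p | p = expVec m₀ ∨ b ⬝ᵥ expVec m₀ < b ⬝ᵥ p} := by
    rintro p hp q hq x y hx hy hxy
    rcases hx.eq_or_lt with rfl | hx
    · simpa [show y = 1 by linarith] using hq
    rcases hy.eq_or_lt with rfl | hy
    · simpa [show x = 1 by linarith] using hp
    simp only [mem_ofPred_eq, dotProduct_add, dotProduct_smul, smul_eq_mul]
    have hv : ∀ v : ℝ, v = x * v + y * v := fun v => by rw [← add_mul, hxy, one_mul]
    rcases hp with rfl | hp
    · rcases hq with rfl | hq
      · left; rw [← add_smul, hxy, one_smul]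
      · right; nlinarith [hv (b ⬝ᵥ expVec m₀), mul_lt_mul_of_pos_left hq hy]
    · have h1 : b ⬝ᵥ expVec m₀ ≤ b ⬝ᵥ q := by
        rcases hq with rfl | hq
        · exact le_rfl
        · exact hq.le
      right
      nlinarith [hv (b ⬝ᵥ expVec m₀), mul_lt_mul_of_pos_left hp hx, mul_le_mul_of_nonneg_left h1 hy.le]
  refine convexHull_min ?_ hconv hp
  refine iUnion₂_subset fun m hm q hq => ?_
  have hmq : b ⬝ᵥ expVec m ≤ b ⬝ᵥ q :=
    Finset.sum_le_sum fun i _ => mul_le_mul_of_nonneg_left (hq i) (hb i).le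
  by_cases h : m = m₀
  · subst h
    by_cases hqm : q = expVec m
    · exact Or.inl hqm
    · obtain ⟨i, hi⟩ := Function.ne_iff.1 hqm
      exact Or.inr (Finset.sum_lt_sum (fun i _ => mul_le_mul_of_nonneg_left (hq i) (hb i).le)
        ⟨i, Finset.mem_univ _, mul_lt_mul_of_pos_left (lt_of_le_of_ne (hq i) hi.symm) (hb i)⟩)
  · exact Or.inr ((hmin m hm h).trans_le hmq)

theorem trace_eq_singleton {d : ℕ} {F : MvPowerSeries (Fin d) ℂ}
    {b : Fin d → ℝ} (hb : ∀ i, 0 < b i) {m₀ : Fin d →₀ ℕ} (hm₀ : MvPowerSeries.coeff m₀ F ≠ 0)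
    (hmin : ∀ m, MvPowerSeries.coeff m F ≠ 0 → m ≠ m₀ → b ⬝ᵥ expVec m₀ < b ⬝ᵥ expVec m) :
    trace F b = {expVec m₀} := by
  have hmem := expVec_mem_newtonPolyhedron hm₀
  refine Subset.antisymm (fun p hp => ?_) ?_
  · exact (eq_or_lt_of_mem_newtonPolyhedron hb hmin hp.1).resolve_right
      (not_lt.2 (hp.2 _ hmem))
  · rintro _ rfl
    refine ⟨hmem, fun q hq => ?_⟩
    rcases eq_or_lt_of_mem_newtonPolyhedron hb hmin hq with rfl | h
    exacts [le_rfl, h.le]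

theorem mem_extremePoints_of_trace_eq_singleton {d : ℕ} {F : MvPowerSeries (Fin d) ℂ}
    {b v : Fin d → ℝ} (h : trace F b = {v}) : v ∈ (newtonPolyhedron F).extremePoints ℝ := by
  have hv : v ∈ trace F b := h ▸ mem_singleton v
  refine ⟨hv.1, fun p hp q hq hpq => ?_⟩
  obtain ⟨x, y, hx, hy, hxy, hv'⟩ := hpq
  have hpv := hv.2 p hp
  have hqv := hv.2 q hq
  have hval : b ⬝ᵥ v = x * (b ⬝ᵥ p) + y * (b ⬝ᵥ q) := by
    rw [← hv', dotProduct_add, dotProduct_smul, dotProduct_smul, smul_eq_mul, smul_eq_mul]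
  have hle : b ⬝ᵥ p ≤ b ⬝ᵥ v := by
    have h2 : y * (b ⬝ᵥ v) ≤ y * (b ⬝ᵥ q) := mul_le_mul_of_nonneg_left hqv hy.le
    have h3 : b ⬝ᵥ v = x * (b ⬝ᵥ v) + y * (b ⬝ᵥ v) := by rw [← add_mul, hxy, one_mul]
    exact le_of_mul_le_mul_left (by linarith) hx
  have : p ∈ trace F b := ⟨hp, fun r hr => hle.trans (hv.2 r hr)⟩
  rwa [h] at this

theorem realVec_dotProduct_expVec {d : ℕ} (α : Fin d → ℕ) (m : Fin d →₀ ℕ) :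
    realVec (fun i => (α i : ℤ)) ⬝ᵥ expVec m = ((∑ i, α i * m i : ℕ) : ℝ) := by
  simp [realVec, expVec, dotProduct]

/-- Infinitely many monomials compete with `m₀`, so the neighbourhood of `a` is chosen
multiplicatively: all weights then change by a factor between `1 - ε` and `1 + ε`, uniformly in `m`.
-/
theorem eventually_trace_eq {d : ℕ} {F : MvPowerSeries (Fin d) ℂ} {α : Fin d → ℕ}
    (hα : ∀ i, 0 < α i) {m₀ : Fin d →₀ ℕ} (hm₀ : MvPowerSeries.coeff m₀ F ≠ 0)
    (hmin : ∀ m, MvPowerSeries.coeff m F ≠ 0 → m ≠ m₀ → ∑ i, α i * m₀ i < ∑ i, α i * m i) :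
    ∀ᶠ b in 𝓝 (realVec fun i => (α i : ℤ)), b ∈ orthant d ∧ trace F b = {expVec m₀} := by
  set a : Fin d → ℝ := realVec fun i => (α i : ℤ) with ha
  have ha0 : ∀ i, 0 < a i := fun i => by simpa [ha, realVec] using hα i
  set k := ∑ i, α i * m₀ i with hk
  -- Weights are integers, so the competitors weigh at least `k + 1`; this `ε` gives `(1 + ε) k < (1
  -- - ε) (k + 1)`.
  set ε : ℝ := 1 / (2 * k + 2) with hε
  have hε0 : 0 < ε := by positivity
  have hεk : ε * (2 * k + 2) = 1 := by rw [hε]; field_simp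
  have hε1 : ε < 1 := by
    rw [hε, div_lt_one (by positivity)]
    have : (0 : ℝ) ≤ k := k.cast_nonneg
    linarith
  have hnhds : ∀ᶠ b in 𝓝 a, ∀ i, (1 - ε) * a i < b i ∧ b i < (1 + ε) * a i := by
    rw [Filter.eventually_all]
    intro i
    have h := (continuous_apply (A := fun _ : Fin d => ℝ) i).tendsto a
    exact (h.eventually_const_lt (by nlinarith [ha0 i])).and
      (h.eventually_lt_const (by nlinarith [ha0 i]))
  filter_upwards [hnhds] with b hb
  have hb0 : ∀ i, 0 < b i := fun i =>
    (mul_pos (by linarith) (ha0 i)).trans (hb i).1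
  refine ⟨?_, trace_eq_singleton hb0 hm₀ fun m hm hne => ?_⟩
  · have : 0 ≤ b := fun i => (hb0 i).le
    simpa [orthant] using this
  · have h1 : b ⬝ᵥ expVec m₀ ≤ (1 + ε) * (a ⬝ᵥ expVec m₀) := by
      rw [dotProduct, dotProduct, Finset.mul_sum]
      refine Finset.sum_le_sum fun i _ => ?_
      rw [← mul_assoc]
      exact mul_le_mul_of_nonneg_right (hb i).2.le (Nat.cast_nonneg _)
    have h2 : (1 - ε) * (a ⬝ᵥ expVec m) ≤ b ⬝ᵥ expVec m := by
      rw [dotProduct, dotProduct, Finset.mul_sum]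
      refine Finset.sum_le_sum fun i _ => ?_
      rw [← mul_assoc]
      exact mul_le_mul_of_nonneg_right (hb i).1.le (Nat.cast_nonneg _)
    have h3 : (k : ℝ) + 1 ≤ a ⬝ᵥ expVec m := by
      rw [ha, realVec_dotProduct_expVec]
      exact_mod_cast hmin m hm hne
    rw [ha, realVec_dotProduct_expVec, ← hk] at h1
    have h4 := mul_le_mul_of_nonneg_left h3 (sub_nonneg.2 hε1.le)
    linarith

/-- If the trace is constant, equal to a vertex, near a covector, then this covector lies in the
interior of a maximal cone of the Newton fan, and in no other cone. -/
theorem newtonFan_of_eventually_trace_eq {d : ℕ} {F : MvPowerSeries (Fin d) ℂ} {a v : Fin d → ℝ}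
    (h : ∀ᶠ b in 𝓝 a, b ∈ orthant d ∧ trace F b = {v}) :
    (∃! C, C ∈ newtonFan F ∧ a ∈ C) ∧
    (∃ C, Maximal (fun D => D ∈ newtonFan F) C ∧ a ∈ interior C) ∧
    (∃ v ∈ (newtonPolyhedron F).extremePoints ℝ, trace F a = {v}) := by
  obtain ⟨haσ, hav⟩ := h.self_of_nhds
  set C₀ := closure {b | b ∈ orthant d ∧ trace F b = trace F a} with hC₀
  have hC₀mem : C₀ ∈ newtonFan F := ⟨a, haσ, rfl⟩
  have hint : a ∈ interior C₀ := by
    rw [mem_interior_iff_mem_nhds]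
    filter_upwards [h] with b hb
    exact subset_closure ⟨hb.1, hb.2.trans hav.symm⟩
  have huniq : ∀ C ∈ newtonFan F, a ∈ C → C = C₀ := by
    rintro _ ⟨a', -, rfl⟩ haC
    obtain ⟨b, hb, hb'⟩ := mem_closure_iff_nhds.1 haC _ h
    -- The class whose closure contains `a` has a member `b` near `a`, so its common trace is `{v}`.
    rw [hC₀, ← hb'.2, hb.2, hav]
  refine ⟨⟨C₀, ⟨hC₀mem, interior_subset hint⟩, fun C hC => huniq C hC.1 hC.2⟩,
    ⟨C₀, ⟨hC₀mem, fun D hD hle => ?_⟩, hint⟩, v, mem_extremePoints_of_trace_eq_singleton hav, hav⟩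
  exact (huniq D hD (hle (interior_subset hint))).le

/-! ### Monomial curves in the toric variety -/

theorem term_monomial {d : ℕ} (F : MvPowerSeries (Fin d) ℂ) (α w : Fin d → ℕ) (t s : ℂ)
    (m : Fin d →₀ ℕ) : term F (fun i => t ^ α i * s ^ w i) m =
      MvPowerSeries.coeff m F * t ^ (∑ i, α i * m i) * s ^ (∑ i, w i * m i) := by
  simp_rw [term, mul_pow, Finset.prod_mul_distrib, ← pow_mul, Finset.prod_pow_eq_pow_sum, mul_assoc]

theorem eventually_monomial_mem {d : ℕ} {U : Set (Fin d → ℂ)} (hU : IsOpen U) (h0 : 0 ∈ U)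
    {α : Fin d → ℕ} (hα : ∀ i, 0 < α i) (w : Fin d → ℕ) (s₀ : ℂ) :
    ∀ᶠ p : ℂ × ℂ in 𝓝 (0, s₀), (fun i => p.1 ^ α i * p.2 ^ w i) ∈ U := by
  have hcont : Continuous fun p : ℂ × ℂ => (fun i => p.1 ^ α i * p.2 ^ w i : Fin d → ℂ) := by
    fun_prop
  refine hcont.continuousAt.preimage_mem_nhds (hU.mem_nhds ?_)
  convert h0 using 1
  ext i
  simp [(hα i).ne']

theorem mem_ray {d : ℕ} (a : Fin d → ℤ) : realVec a ∈ ray a :=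
  Submodule.subset_span (mem_singleton _)

theorem mem_ray_iff {d : ℕ} (a : Fin d → ℤ) (u : Fin d → ℝ) :
    u ∈ ray a ↔ ∃ r : ℝ, 0 ≤ r ∧ u = r • realVec a := by
  rw [ray, PointedCone.hull, Submodule.mem_span_singleton]
  constructor
  · rintro ⟨r, rfl⟩
    exact ⟨r.1, r.2, rfl⟩
  · rintro ⟨r, hr, rfl⟩
    exact ⟨⟨r, hr⟩, rfl⟩

theorem realVec_dotProduct {d : ℕ} (a m : Fin d → ℤ) :
    realVec a ⬝ᵥ realVec m = ((a ⬝ᵥ m : ℤ) : ℝ) := by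
  simp [realVec, dotProduct]

theorem dotProduct_nonneg_of_mem_dualMonoid {d : ℕ} {a m : Fin d → ℤ}
    (hm : m ∈ dualMonoid (ray a)) : 0 ≤ a ⬝ᵥ m := by
  have := hm _ (mem_ray a)
  rw [realVec_dotProduct] at this
  exact_mod_cast this

/-- The point `x^m = t^{(a, m)} s^{(w, m)}` of the chart of the ray spanned by `a`. -/
def monomialPoint {d : ℕ} (a w : Fin d → ℤ) (p : ℂ × {s : ℂ // s ≠ 0}) : AffineToric (ray a) :=
  ⟨fun m => p.1 ^ (a ⬝ᵥ m.1).toNat * (p.2 : ℂ) ^ (w ⬝ᵥ m.1), by simp, fun m m' => by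
    have h := dotProduct_nonneg_of_mem_dualMonoid m.2
    have h' := dotProduct_nonneg_of_mem_dualMonoid m'.2
    simp only [AddSubmonoid.coe_add]
    rw [dotProduct_add, dotProduct_add, Int.toNat_add h h',
      zpow_add₀ p.2.2, pow_add]
    ring⟩

theorem continuous_monomialPoint {d : ℕ} (a w : Fin d → ℤ) : Continuous (monomialPoint a w) := by
  refine Continuous.subtype_mk (continuous_pi fun m => ?_) _
  exact (continuous_fst.pow _).mul
    ((continuous_subtype_val.comp continuous_snd).zpow₀ _ fun p => Or.inl p.2.2)

theorem continuous_chart {d : ℕ} {Δ : Set (PointedCone ℝ (Fin d → ℝ))} (τ : Δ) :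
    Continuous (chart τ) :=
  continuous_quot_mk.comp continuous_sigmaMk

theorem continuous_toricMap {d : ℕ} {Δ : Set (PointedCone ℝ (Fin d → ℝ))}
    (hΔ : ∀ τ ∈ Δ, τ ≤ orthant d) : Continuous (toricMap Δ hΔ) := by
  refine continuous_coinduced_dom.2 (continuous_sigma fun τ => continuous_pi fun i => ?_)
  change Continuous fun x : AffineToric τ.1 =>
    x.1 ⟨Pi.single i 1, single_mem_dualMonoid (hΔ τ.1 τ.2) i⟩
  exact (continuous_apply _).comp continuous_subtype_val

/-- At `t = 0` the convention `0 ^ 0 = 1` keeps exactly the characters orthogonal to `a` nonzero. -/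
theorem chart_monomialPoint_mem_orbit {d : ℕ} {Δ : Set (PointedCone ℝ (Fin d → ℝ))}
    {a : Fin d → ℤ} (ha : ray a ∈ Δ) (w : Fin d → ℤ) (s : {s : ℂ // s ≠ 0}) :
    chart ⟨ray a, ha⟩ (monomialPoint a w (0, s)) ∈ orbit (⟨ray a, ha⟩ : Δ) := by
  refine ⟨_, fun m => ?_, rfl⟩
  have h := dotProduct_nonneg_of_mem_dualMonoid m.2
  have hs : (s : ℂ) ^ (w ⬝ᵥ m.1) ≠ 0 := zpow_ne_zero _ s.2
  have h1 : (monomialPoint a w (0, s)).1 m ≠ 0 ↔ a ⬝ᵥ m.1 = 0 := by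
    change (0 : ℂ) ^ (a ⬝ᵥ m.1).toNat * (s : ℂ) ^ (w ⬝ᵥ m.1) ≠ 0 ↔ _
    rw [mul_ne_zero_iff_right hs, Ne, pow_eq_zero_iff']
    simp only [true_and, not_not, Ne]
    omega
  rw [h1]
  constructor
  · intro h0 u hu
    obtain ⟨r, -, rfl⟩ := (mem_ray_iff a u).1 hu
    rw [smul_dotProduct, realVec_dotProduct, h0]
    simp
  · intro h0
    have := h0 _ (mem_ray a)
    rw [realVec_dotProduct] at this
    exact_mod_cast this

theorem toricMap_chart_monomialPoint {d : ℕ} {Δ : Set (PointedCone ℝ (Fin d → ℝ))}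
    (hΔ : ∀ τ ∈ Δ, τ ≤ orthant d) {α : Fin d → ℕ} (ha : (ray fun i => (α i : ℤ)) ∈ Δ)
    (w : Fin d → ℕ) (t : ℂ) (s : {s : ℂ // s ≠ 0}) :
    toricMap Δ hΔ (chart ⟨_, ha⟩ (monomialPoint _ (fun i => (w i : ℤ)) (t, s))) =
      fun i => t ^ α i * (s : ℂ) ^ w i := by
  ext i
  change t ^ ((fun i => (α i : ℤ)) ⬝ᵥ Pi.single i 1).toNat *
    (s : ℂ) ^ ((fun i => (w i : ℤ)) ⬝ᵥ Pi.single i 1) = _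
  simp

/-- Used to see that points with all coordinates nonzero avoid the image of the exceptional locus.
Vanishing of the product is a closed condition, so it is enough to check it on the orbits of the
rays. -/
theorem prod_toricMap_eq_zero {d : ℕ} {Δ : Set (PointedCone ℝ (Fin d → ℝ))}
    (hΔ : ∀ τ ∈ Δ, τ ≤ orthant d) {p : ToricVariety Δ} (hp : p ∈ exceptionalLocus Δ) :
    ∏ i, toricMap Δ hΔ p i = 0 := by
  simp only [exceptionalLocus, mem_iUnion] at hp
  obtain ⟨b, hb, hb0, -, hp⟩ := hp
  have hclosed : IsClosed {p | ∏ i, toricMap Δ hΔ p i = 0} := by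
    refine isClosed_eq (continuous_finsetProd _ fun i _ => ?_) continuous_const
    exact (continuous_apply i).comp (continuous_toricMap hΔ)
  refine closure_minimal ?_ hclosed hp
  rintro _ ⟨x, hx, rfl⟩
  obtain ⟨i, hi⟩ := Function.ne_iff.1 hb0
  refine Finset.prod_eq_zero (Finset.mem_univ i) ?_
  by_contra hne
  have := (hx ⟨Pi.single i 1, single_mem_dualMonoid (hΔ _ hb) i⟩).1 hne _ (mem_ray b)
  rw [realVec_dotProduct] at this
  apply hi
  simpa using this

theorem exists_injOn_weights {d : ℕ} (k : ℕ) :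
    ∃ w : Fin d → ℕ, InjOn (fun m : Fin d →₀ ℕ => ∑ i, w i * m i) {m | ∀ i, m i ≤ k} := by
  -- Exponents at most `k` are digits in base `k + 1`.
  refine ⟨fun i => (k + 1) ^ (i : ℕ), fun m hm m' hm' h => ?_⟩
  let f : (m : Fin d →₀ ℕ) → (∀ i, m i ≤ k) → Fin d → Fin (k + 1) :=
    fun m hm i => ⟨m i, Nat.lt_succ_of_le (hm i)⟩
  have hf : f m hm = f m' hm' := by
    apply finFunctionFinEquiv.injective
    apply Fin.ext
    rw [finFunctionFinEquiv_apply, finFunctionFinEquiv_apply]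
    simpa only [f, mul_comm] using h
  ext i
  exact congrArg Fin.val (congrFun hf i)

/-- If two monomials of `F` have the same minimal weight, the divisor meets the proper transform. -/
theorem divisor_inter_properTransform_nonempty {d : ℕ} {F : MvPowerSeries (Fin d) ℂ}
    {U : Set (Fin d → ℂ)} (hU : IsOpen U) (h0 : 0 ∈ U) (hF : ∀ x ∈ U, Summable (term F x))
    {Δ : Set (PointedCone ℝ (Fin d → ℝ))} (hΔ : ∀ τ ∈ Δ, τ ≤ orthant d)
    {α : Fin d → ℕ} (hα : ∀ i, 0 < α i) (ha : (ray fun i => (α i : ℤ)) ∈ Δ)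
    {m₁ m₂ : Fin d →₀ ℕ} (hne : m₁ ≠ m₂) (h₁ : MvPowerSeries.coeff m₁ F ≠ 0)
    (h₂ : MvPowerSeries.coeff m₂ F ≠ 0) (h₁₂ : ∑ i, α i * m₂ i = ∑ i, α i * m₁ i)
    (hmin : ∀ m, MvPowerSeries.coeff m F ≠ 0 → ∑ i, α i * m₁ i ≤ ∑ i, α i * m i) :
    (divisor _ ha ∩ properTransform Δ hΔ (hypersurface F U)).Nonempty := by
  set k := ∑ i, α i * m₁ i with hk
  obtain ⟨w, hw⟩ := exists_injOn_weights (d := d) k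
  -- As every `α i ≥ 1`, exponents of weight `k` are bounded by `k`: there are finitely many, and
  -- `w` separates them.
  have hle : ∀ m : Fin d →₀ ℕ, ∑ i, α i * m i = k → ∀ i, m i ≤ k := fun m hm i =>
    calc m i ≤ α i * m i := Nat.le_mul_of_pos_left _ (hα i)
      _ ≤ ∑ i, α i * m i :=
        Finset.single_le_sum (f := fun i => α i * m i) (fun _ _ => Nat.zero_le _)
          (Finset.mem_univ i)
      _ = k := hm
  have hfin : {m : Fin d →₀ ℕ | MvPowerSeries.coeff m F ≠ 0 ∧ ∑ i, α i * m i = k}.Finite :=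
    (Set.finite_Iic (Finsupp.equivFunOnFinite.symm fun _ => k)).subset
      fun m hm i => by simpa using hle m hm.2 i
  have hS : ∀ m, m ∈ hfin.toFinset ↔ MvPowerSeries.coeff m F ≠ 0 ∧ ∑ i, α i * m i = k :=
    fun m => by simp
  obtain ⟨s₀, hs₀, hzero⟩ := exists_zero_near (fun m => MvPowerSeries.coeff m F)
    (fun m => ∑ i, α i * m i) (fun m => ∑ i, w i * m i) k hmin hfin.toFinset hS
    (hw.mono fun m hm => hle m ((hS m).1 hm).2) ((hS m₁).2 ⟨h₁, rfl⟩) ((hS m₂).2 ⟨h₂, h₁₂⟩) hne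
    (by
      intro R hR
      -- However large `R` is, the point `t^α R^w` lies in `U` for small `t`, since all `α i` are
      -- positive; convergence there gives the summability.
      obtain ⟨ε, hε, hball⟩ := Metric.eventually_nhds_iff.1
        (eventually_monomial_mem hU h0 hα w (R : ℂ))
      have hmem := hball (y := (((ε / 2 : ℝ) : ℂ), (R : ℂ))) (by
        rw [Prod.dist_eq, dist_self, max_lt_iff, dist_zero_right, Complex.norm_real,
          Real.norm_of_nonneg (by positivity)]
        exact ⟨by linarith, hε⟩)
      refine ⟨ε / 2, half_pos hε, (hF _ hmem).norm.congr fun m => ?_⟩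
      rw [term_monomial, norm_mul, norm_mul, norm_pow, norm_pow, Complex.norm_real,
        Complex.norm_real, Real.norm_of_nonneg hR.le, Real.norm_of_nonneg (by positivity)])
  let φ : ℂ × {s : ℂ // s ≠ 0} → ToricVariety Δ :=
    fun p => chart ⟨_, ha⟩ (monomialPoint _ (fun i => (w i : ℤ)) p)
  have hφ : Continuous φ := (continuous_chart _).comp (continuous_monomialPoint _ _)
  refine ⟨φ (0, ⟨s₀, hs₀⟩), subset_closure (chart_monomialPoint_mem_orbit ha _ _), ?_⟩
  obtain ⟨ε₀, hε₀, hball⟩ := Metric.eventually_nhds_iff.1 (eventually_monomial_mem hU h0 hα w s₀)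
  -- The closure is taken in the parameters `(t, s)` and transported by continuity of `φ`.
  refine map_mem_closure hφ (s := φ ⁻¹' (toricMap Δ hΔ ⁻¹' (hypersurface F U \
    toricMap Δ hΔ '' exceptionalLocus Δ))) (Metric.mem_closure_iff.2 fun ε hε => ?_) fun p hp => hp
  -- The bound `ε₀` keeps the point in `U`, and `‖s₀‖` keeps `s` away from `0`.
  obtain ⟨t, s, ht0, ht, hs, hts⟩ := hzero (min (min ε ε₀) ‖s₀‖)
    (lt_min (lt_min hε hε₀) (norm_pos_iff.2 hs₀))
  simp only [lt_min_iff] at ht hs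
  have hs0 : s ≠ 0 := by
    rintro rfl
    simp at hs
  refine ⟨(t, ⟨s, hs0⟩), ?_, ?_⟩
  · have hmap : toricMap Δ hΔ (φ (t, ⟨s, hs0⟩)) = fun i => t ^ α i * s ^ w i :=
      toricMap_chart_monomialPoint hΔ ha w t ⟨s, hs0⟩
    rw [mem_preimage, mem_preimage, hmap]
    refine ⟨⟨hball (y := (t, s)) ?_, ?_⟩, ?_⟩
    · rw [Prod.dist_eq, max_lt_iff, dist_zero_right, dist_eq_norm]
      exact ⟨ht.1.2, hs.1.2⟩
    · simp_rw [term_monomial]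
      exact hts
    · rintro ⟨p, hp, hpe⟩
      have := prod_toricMap_eq_zero hΔ hp
      rw [hpe] at this
      refine Finset.prod_ne_zero_iff.2 (fun i _ => ?_) this
      exact mul_ne_zero (pow_ne_zero _ ht0) (pow_ne_zero _ hs0)
  · rw [Prod.dist_eq, max_lt_iff, dist_zero_left, dist_comm, Subtype.dist_eq, dist_eq_norm]
    exact ⟨ht.1.1, hs.1.1⟩

end NewtonToric

end

theorem mainTheorem3 (n : ℕ)
    -- the hypersurface `X = (F = 0)` in an open neighbourhood `U` of the origin of `ℂ^{n+1}`
    (F : MvPowerSeries (Fin (n + 1)) ℂ) (U : Set (Fin (n + 1) → ℂ))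
    (hU : IsOpen U) (h0 : (0 : Fin (n + 1) → ℂ) ∈ U)
    (hF : ∀ x ∈ U, Summable (NewtonToric.term F x))
    -- `X` contains none of the coordinate hyperplanes
    (hX : ∀ i, ¬ {x ∈ U | x i = 0} ⊆ NewtonToric.hypersurface F U)
    (Δ : Set (PointedCone ℝ (Fin (n + 1) → ℝ)))
    (hΔ : NewtonToric.IsSimpleSubdivision Δ F)
    -- a lattice vector in the relative interior of the standard cone that spans a ray of `Δ`
    (a : Fin (n + 1) → ℤ) (ha : ∀ i, 0 < a i) (haΔ : NewtonToric.ray a ∈ Δ)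
    (hE : NewtonToric.divisor a haΔ ∩
      NewtonToric.properTransform Δ hΔ.le_orthant (NewtonToric.hypersurface F U) = ∅) :
    -- `a` belongs to a unique cone of the Newton fan
    (∃! C, C ∈ NewtonToric.newtonFan F ∧ NewtonToric.realVec a ∈ C) ∧
    -- it lies in the interior of a maximal cone of the Newton fan
    (∃ C, Maximal (fun D => D ∈ NewtonToric.newtonFan F) C ∧
      NewtonToric.realVec a ∈ interior C) ∧
    -- and its trace is a vertex of the Newton polyhedron
    (∃ v ∈ (NewtonToric.newtonPolyhedron F).extremePoints ℝ,
      NewtonToric.trace F (NewtonToric.realVec a) = {v}) := by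
  obtain ⟨α, rfl⟩ : ∃ α : Fin (n + 1) → ℕ, a = fun i => (α i : ℤ) :=
    ⟨fun i => (a i).toNat, funext fun i => (Int.toNat_of_nonneg (ha i).le).symm⟩
  have hα : ∀ i, 0 < α i := fun i => Int.natCast_pos.1 (ha i)
  have hne : {m : Fin (n + 1) →₀ ℕ | MvPowerSeries.coeff m F ≠ 0}.Nonempty := by
    by_contra hempty
    have hzero : ∀ m, MvPowerSeries.coeff m F = 0 := fun m => by
      by_contra hm
      exact hempty ⟨m, hm⟩
    -- If `F` were zero, `X` would be all of `U` and contain a coordinate hyperplane.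
    exact hX 0 fun x hx => ⟨hx.1, by simp [NewtonToric.term, hzero]⟩
  obtain ⟨m₀, hm₀, hmin⟩ := exists_minimalFor_of_wellFoundedLT
    (fun m : Fin (n + 1) →₀ ℕ => MvPowerSeries.coeff m F ≠ 0) (fun m => ∑ i, α i * m i) hne
  have hmin' : ∀ m, MvPowerSeries.coeff m F ≠ 0 → ∑ i, α i * m₀ i ≤ ∑ i, α i * m i :=
    fun m hm => (le_total _ _).elim id fun h => hmin hm h
  refine NewtonToric.newtonFan_of_eventually_trace_eq (NewtonToric.eventually_trace_eq hα hm₀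
    fun m hm hmne => lt_of_le_of_ne (hmin' m hm) fun heq => ?_)
  exact (NewtonToric.divisor_inter_properTransform_nonempty hU h0 hF hΔ.le_orthant hα haΔ
    hmne.symm hm₀ hm heq.symm hmin').ne_empty hE
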